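/- **Proposition (Utility maximization).** Let $U\colon\mathbb{R}\to\mathbb{R}$ be concave and increasing (not necessarily strictly), let $e\in\mathbb{N}$ (with $e=0$ allowed), and let $B,K\in\mathbb{R}$. There are constants $c,C>0$, depending only on $U,e,B,K$, such that the following holds. Let $\mathcal{X}$ be a measurable space, $\mu$ a probability measure on $\mathcal{X}$, let $F,G_1,\dots,G_e\colon\mathcal{X}\to\mathbb{R}$ be measurable with $|F|\le B$ and $|G_i|\le B$ for all $i$, and let $\mathcal{G}\subset\mathbb{R}^e$ be nonempty with $|g|\le K$ (Euclidean norm) for all $g\in\mathcal{G}$. For a probability measure $\nu$ on $\mathcal{X}$ set \[ u_{\max}^{\nu}(F):=\sup_{g\in\mathcal{G}} \int_{\mathcal{X}} U\Big(F(x)+\sum_{i=1}^e g_i G_i(x)\Big)\,\nu(dx). \] The integrals and the supremum are finite for every $\nu$. Moreover, for every $N\ge 1$, if $S_1,\dots,S_N$ are independent $\mathcal{X}$-valued random variables with law $\mu$, defined on some probability space with probability $P$ and expectation $E$, and $\mu_N:=\frac1N\sum_{n=1}^N\delta_{S_n}$ is their empirical measure, then the error $|u_{\max}^{\mu}(F)-u_{\max}^{\mu_N}(F)|$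 is $P$-integrable and \[ E\Big[\big|u_{\max}^{\mu}(F)-u_{\max}^{\mu_N}(F)\big|\Big]\le\frac{C}{\sqrt N}, \] \[ P\Big[\big|u_{\max}^{\mu}(F)-u_{\max}^{\mu_N}(F)\big|\ge\varepsilon\Big]\le C\exp\big(-cN\varepsilon^2\big)\quad\text{for all }\varepsilon>0. \] -/

import Mathlib

open MeasureTheory ProbabilityTheory

noncomputable section

/-- The empirical measure `(1/N) ∑ i, δ_{x i}` of the sample `x 0, …, x (N-1)`. -/
def empiricalMeasure {𝒳 : Type*} [MeasurableSpace 𝒳] {N : ℕ} (x : Fin N → 𝒳) : Measure 𝒳 :=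
  (N : ENNReal)⁻¹ • ∑ i, Measure.dirac (x i)

/-- The empirical measure of at least one observation is a probability measure. -/
theorem isProbabilityMeasure_empiricalMeasure {𝒳 : Type*} [MeasurableSpace 𝒳] {N : ℕ}
    (hN : 1 ≤ N) (x : Fin N → 𝒳) : IsProbabilityMeasure (empiricalMeasure x) := by
  constructor
  have h0 : (N : ENNReal) ≠ 0 := by
    simp only [ne_eq, Nat.cast_eq_zero]
    omega
  simp [empiricalMeasure, ENNReal.inv_mul_cancel h0 (ENNReal.natCast_ne_top N)]

/-- The outcome `F + g · G = F + ∑ i, g i * G i` of the position `F` after trading according to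
the strategy `g` in the options `G 0, …, G (e-1)`. -/
def tradedPosition {𝒳 : Type*} {e : ℕ} (F : 𝒳 → ℝ) (G : Fin e → 𝒳 → ℝ)
    (g : EuclideanSpace ℝ (Fin e)) (x : 𝒳) : ℝ :=
  F x + ∑ i, g i * G i x

/-- The expected utility `u^ν(H) = E^ν[U(H(S))]`, where `S` has law `ν`. -/
def expectedUtility {𝒳 : Type*} [MeasurableSpace 𝒳] (U : ℝ → ℝ) (ν : Measure 𝒳)
    (H : 𝒳 → ℝ) : ℝ :=
  ∫ x, U (H x) ∂ν

/-- The maximal expected utility `sup_{g ∈ 𝒢} u^ν(F + g · G)`. -/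
def maxUtility {𝒳 : Type*} [MeasurableSpace 𝒳] {e : ℕ} (U : ℝ → ℝ) (G : Fin e → 𝒳 → ℝ)
    (𝒢 : Set (EuclideanSpace ℝ (Fin e))) (ν : Measure 𝒳) (F : 𝒳 → ℝ) : ℝ :=
  sSup ((fun g => expectedUtility U ν (tradedPosition F G g)) '' 𝒢)

end

/-! All positions lie in a fixed interval `[-R, R]`. There `U` is Lipschitz, and this is all that
concavity is used for. So `U` minus `U 0`, along the position of strategy `g`, is a Lipschitz image
vanishing at zero of the linear form with weights `(1, g)` in the functions `F, G 0, …, G (e-1)`.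
The error is at most the largest deviation of an empirical mean over this family.

The moment generating function of that deviation is bounded one observation at a time.
Symmetrization replaces a centered summand by one with a random sign
(`lintegral_sup'_exp_centered_le`), and contraction replaces `U` by the linear form
(`sup'_exp_add_sup'_exp_le`). The supremum of the exponential of a linear form is at most a sum of
hyperbolic cosines (`exp_sum_le_sum_cosh`), and each new random sign multiplies such a cosine by at
most a Gaussian factor. Induction on `N` yields a sub-Gaussian bound free of chaining and of the
size of the family, from which both assertions follow by exponential inequalities.

The suprema are taken over finite nets of `𝒢`. The estimate does not depend on the net, so the mesh
may tend to zero; the nets also give measurability. -/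

/-! ### Local Lipschitz bound for the utility -/

/-- A concave increasing function on the line is Lipschitz on every interval `[-R, R]`. -/
theorem exists_abs_sub_le_of_concaveOn_of_monotone {U : ℝ → ℝ} (hU : ConcaveOn ℝ Set.univ U)
    (hUmono : Monotone U) (R : ℝ) :
    ∃ L : ℝ, 0 ≤ L ∧ ∀ x y : ℝ, |x| ≤ R → |y| ≤ R → |U x - U y| ≤ L * |x - y| := by
  -- With `ε = 1` the Lipschitz bound holds on the open ball of radius `R + 1`, which contains `[-R,
  -- R]`. Monotonicity bounds `U` on the larger ball by its values at the endpoints.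
  have h := (hU.subset (Set.subset_univ (Metric.ball 0 (R + 2)))
    (convex_ball _ _)).lipschitzOnWith_of_abs_le (ε := 1) (M := max |U (R + 2)| |U (-(R + 2))|)
      one_pos (fun a ha => by
        have ha' : |a - 0| < R + 2 := ha
        rw [sub_zero] at ha'
        exact abs_le_max_abs_abs (hUmono (abs_lt.1 ha').1.le) (hUmono (abs_lt.1 ha').2.le)
          |>.trans (le_of_eq (max_comm _ _)))
  refine ⟨(2 * max |U (R + 2)| |U (-(R + 2))| / 1).toNNReal, NNReal.coe_nonneg _, fun x y hx hy => ?_⟩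
  have := h.dist_le_mul x (by simp; linarith) y (by simp; linarith)
  simpa only [Real.dist_eq] using this

/-! ### Contraction and symmetrization in one variable -/

/-- The contraction principle for one random sign, for the exponential of a supremum. -/
theorem sup'_exp_add_sup'_exp_le {τ : Type*} {T : Finset τ} (hT : T.Nonempty) (h φ a : τ → ℝ)
    (hφ : ∀ s t, |φ s - φ t| ≤ |a s - a t|) (h0 : ∀ t, |φ t| ≤ |a t|) :
    (T.sup' hT fun t => Real.exp (h t + φ t)) + (T.sup' hT fun t => Real.exp (h t - φ t)) ≤
      (T.sup' hT fun t => Real.exp (h t + a t)) + T.sup' hT fun t => Real.exp (h t - a t) := by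
  obtain ⟨s, hs, hs'⟩ := T.exists_mem_eq_sup' hT fun t => Real.exp (h t + φ t)
  obtain ⟨t, ht, ht'⟩ := T.exists_mem_eq_sup' hT fun t => Real.exp (h t - φ t)
  rw [hs', ht']
  set p := T.sup' hT fun t => Real.exp (h t + a t)
  set q := T.sup' hT fun t => Real.exp (h t - a t)
  have hp : ∀ r ∈ T, Real.exp (h r + a r) ≤ p :=
    fun r hr => T.le_sup' (fun t => Real.exp (h t + a t)) hr
  have hq : ∀ r ∈ T, Real.exp (h r - a r) ≤ q :=
    fun r hr => T.le_sup' (fun t => Real.exp (h t - a t)) hr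
  have hp0 : 0 < p := (Real.exp_pos _).trans_le (hp s hs)
  have hq0 : 0 < q := (Real.exp_pos _).trans_le (hq s hs)
  have hmax : ∀ r ∈ T, ∀ y, |y| ≤ |a r| → Real.exp (h r + y) ≤ max p q := by
    intro r hr y hy
    rcases le_abs.1 (le_refl |a r|) with h1 | h1
    · exact le_max_of_le_left
        ((Real.exp_le_exp.2 (by linarith [le_abs_self y])).trans (hp r hr))
    · exact le_max_of_le_right
        ((Real.exp_le_exp.2 (by linarith [le_abs_self y])).trans (hq r hr))
  have hx := hmax s hs (φ s) (h0 s)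
  have hy := hmax t ht (-φ t) (by rw [abs_neg]; exact h0 t)
  rw [← sub_eq_add_neg] at hy
  -- The sign of `a s - a t` decides which of `s`, `t` is tested in `p` and which in `q`.
  have hxy : Real.exp (h s + φ s) * Real.exp (h t - φ t) ≤ p * q := by
    have hle := (le_abs_self _).trans (hφ s t)
    rw [← Real.exp_add]
    rcases le_abs.1 (le_refl |a s - a t|) with h1 | h1
    · refine le_trans ?_ (mul_le_mul (hp s hs) (hq t ht) (Real.exp_pos _).le hp0.le)
      rw [← Real.exp_add]
      exact Real.exp_le_exp.2 (by linarith)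
    · refine le_trans ?_ (mul_le_mul (hp t ht) (hq s hs) (Real.exp_pos _).le hp0.le)
      rw [← Real.exp_add]
      exact Real.exp_le_exp.2 (by linarith)
  -- If `x, y ≤ m = max p q` and `x * y ≤ p * q`, then `(m - x) * (m - y) ≥ 0` gives `m * (x + y) ≤
  -- m ^ 2 + p * q = m * (p + q)`.
  rcases le_total p q with h1 | h1
  · rw [max_eq_right h1] at hx hy
    nlinarith [mul_nonneg (sub_nonneg.2 hx) (sub_nonneg.2 hy)]
  · rw [max_eq_left h1] at hx hy
    nlinarith [mul_nonneg (sub_nonneg.2 hx) (sub_nonneg.2 hy)]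

theorem measurable_sup'_exp {α τ : Type*} [MeasurableSpace α] {T : Finset τ} (hT : T.Nonempty)
    {f : τ → α → ℝ} (hf : ∀ t, Measurable (f t)) :
    Measurable fun x => T.sup' hT fun t => Real.exp (f t x) := by
  have := Finset.measurable_sup' hT (f := fun t x => Real.exp (f t x))
    fun t _ => (hf t).exp
  convert this using 1
  ext x
  simp

theorem sup'_exp_nonneg {τ : Type*} {T : Finset τ} (hT : T.Nonempty) (f : τ → ℝ) :
    0 ≤ T.sup' hT fun t => Real.exp (f t) := by
  obtain ⟨t, ht⟩ := hT
  exact (Real.exp_pos _).le.trans (T.le_sup' (fun t => Real.exp (f t)) ht)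

/-- Symmetrization in one variable, for the exponential of a supremum. -/
theorem lintegral_sup'_exp_centered_le {𝒳 τ : Type*} [MeasurableSpace 𝒳] (μ : Measure 𝒳)
    [IsProbabilityMeasure μ] {T : Finset τ} (hT : T.Nonempty) (h : τ → ℝ) {φ : τ → 𝒳 → ℝ}
    (hφ : ∀ t, Measurable (φ t)) {M : ℝ} (hM : ∀ t x, |φ t x| ≤ M) :
    ∫⁻ x, ENNReal.ofReal (T.sup' hT fun t => Real.exp (h t + (φ t x - ∫ y, φ t y ∂μ))) ∂μ ≤
      ∫⁻ x, ENNReal.ofReal (((T.sup' hT fun t => Real.exp (h t + 2 * φ t x)) +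
        T.sup' hT fun t => Real.exp (h t - 2 * φ t x)) / 2) ∂μ := by
  set c := ∫⁻ x, ENNReal.ofReal ((T.sup' hT fun t => Real.exp (h t - 2 * φ t x)) / 2) ∂μ with hc
  have hint : ∀ t, Integrable (φ t) μ := fun t =>
    .of_bound (hφ t).aestronglyMeasurable M (.of_forall fun x => hM t x)
  -- Jensen moves the mean out of the exponential; `c` plays the part of an independent copy of the
  -- variable.
  have hjensen : ∀ t ∈ T, ENNReal.ofReal (Real.exp (h t - 2 * ∫ y, φ t y ∂μ) / 2) ≤ c := by
    intro t ht
    have hexp : Integrable (fun x => Real.exp (h t - 2 * φ t x)) μ := by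
      refine .of_bound (by fun_prop) (Real.exp (h t + 2 * M)) (.of_forall fun x => ?_)
      rw [Real.norm_eq_abs, Real.abs_exp, Real.exp_le_exp]
      linarith [(abs_le.1 (hM t x)).1]
    have hle := convexOn_exp.map_integral_le (μ := μ) (f := fun x => h t - 2 * φ t x)
      Real.continuous_exp.continuousOn isClosed_univ (.of_forall fun _ => Set.mem_univ _)
      ((integrable_const _).sub ((hint t).const_mul 2)) hexp
    rw [integral_sub (integrable_const _) ((hint t).const_mul 2), integral_const_mul] at hle
    simp only [integral_const, probReal_univ, one_smul] at hle
    calc _ ≤ ENNReal.ofReal (∫ x, Real.exp (h t - 2 * φ t x) / 2 ∂μ) := by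
          rw [integral_div]
          exact ENNReal.ofReal_le_ofReal (by simpa using div_le_div_of_nonneg_right hle two_pos.le)
      _ = ∫⁻ x, ENNReal.ofReal (Real.exp (h t - 2 * φ t x) / 2) ∂μ :=
          ofReal_integral_eq_lintegral_ofReal (hexp.div_const 2) (.of_forall fun x => by positivity)
      _ ≤ c := lintegral_mono fun x => ENNReal.ofReal_le_ofReal <|
          div_le_div_of_nonneg_right
            (T.le_sup' (fun t => Real.exp (h t - 2 * φ t x)) ht) two_pos.le
  calc _ ≤ ∫⁻ x, (ENNReal.ofReal ((T.sup' hT fun t => Real.exp (h t + 2 * φ t x)) / 2) + c) ∂μ := by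
        refine lintegral_mono fun x => ?_
        obtain ⟨t, ht, ht'⟩ := T.exists_mem_eq_sup' hT
          fun t => Real.exp (h t + (φ t x - ∫ y, φ t y ∂μ))
        simp only [ht']
        refine le_trans ?_ (add_le_add (ENNReal.ofReal_le_ofReal <| div_le_div_of_nonneg_right
          (T.le_sup' (fun t => Real.exp (h t + 2 * φ t x)) ht) two_pos.le) (hjensen t ht))
        rw [← ENNReal.ofReal_add (by positivity) (by positivity)]
        refine ENNReal.ofReal_le_ofReal ?_
        -- The exponential at a midpoint is at most the mean of the exponentials; this is the origin
        -- of the factor 2 before `φ`.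
        have hsq := fun u v : ℝ => two_mul_le_add_sq (Real.exp (u / 2)) (Real.exp (v / 2))
        have := hsq (h t + 2 * φ t x) (h t - 2 * ∫ y, φ t y ∂μ)
        rw [mul_assoc, ← Real.exp_add, ← Real.exp_nat_mul, ← Real.exp_nat_mul] at this
        push_cast at this
        rw [mul_div_cancel₀ _ two_ne_zero, mul_div_cancel₀ _ two_ne_zero] at this
        rw [show h t + (φ t x - ∫ y, φ t y ∂μ) =
          (h t + 2 * φ t x) / 2 + (h t - 2 * ∫ y, φ t y ∂μ) / 2 by ring]
        linarith
    _ = _ := by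
        rw [lintegral_add_right _ measurable_const, lintegral_const, measure_univ, mul_one, hc,
          ← lintegral_add_right _
            ((measurable_sup'_exp hT fun t => by fun_prop).div_const 2).ennreal_ofReal]
        refine lintegral_congr fun x => ?_
        rw [← ENNReal.ofReal_add (div_nonneg (sup'_exp_nonneg hT _) two_pos.le)
          (div_nonneg (sup'_exp_nonneg hT _) two_pos.le), add_div]

/-! ### Sub-Gaussian bounds for the moment generating function -/

/-- The exponential of a linear form with bounded weights is dominated by a sum of hyperbolic
cosines. -/
theorem exp_sum_le_sum_cosh {ι : Type*} [Fintype ι] [Nonempty ι] {k : ℝ} (v z : ι → ℝ)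
    (hv : ∀ i, |v i| ≤ k) :
    Real.exp (∑ i, v i * z i) ≤ ∑ i, 2 * Real.cosh (Fintype.card ι * k * z i) := by
  obtain ⟨j, -, hj⟩ := Finset.exists_max_image Finset.univ (fun i => |z i|) Finset.univ_nonempty
  have hk : 0 ≤ k := (abs_nonneg _).trans (hv j)
  have h1 : ∑ i, v i * z i ≤ |Fintype.card ι * k * z j| := by
    calc ∑ i, v i * z i ≤ ∑ _i : ι, k * |z j| := Finset.sum_le_sum fun i hi =>
          (le_abs_self _).trans (by
            rw [abs_mul]
            exact mul_le_mul (hv i) (hj i hi) (abs_nonneg _) hk)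
      _ = _ := by
          rw [abs_mul, abs_of_nonneg (mul_nonneg (Nat.cast_nonneg _) hk)]
          simp [mul_assoc]
  have h2 : Real.exp |Fintype.card ι * k * z j| ≤ 2 * Real.cosh (Fintype.card ι * k * z j) := by
    rw [← Real.cosh_abs, Real.cosh_eq]
    linarith [Real.exp_pos (-|Fintype.card ι * k * z j|)]
  exact (Real.exp_le_exp.2 h1).trans <| h2.trans <| Finset.single_le_sum
    (f := fun i => 2 * Real.cosh (Fintype.card ι * k * z i))
    (fun i _ => by linarith [Real.cosh_pos (Fintype.card ι * k * z i)]) (Finset.mem_univ j)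

/-- A sub-Gaussian bound for the moment generating function of the supremum of a centered
empirical process that is dominated, in the sense of contractions, by a linear process. -/
theorem lintegral_sup'_exp_sum_centered_le {𝒳 τ ι : Type*} [MeasurableSpace 𝒳] (μ : Measure 𝒳)
    [IsProbabilityMeasure μ] [Fintype ι] [Nonempty ι] {T : Finset τ} (hT : T.Nonempty)
    {φ : τ → 𝒳 → ℝ} (hφ : ∀ t, Measurable (φ t)) {M : ℝ} (hM : ∀ t x, |φ t x| ≤ M)
    {v : τ → ι → ℝ} {k : ℝ} (hv : ∀ t i, |v t i| ≤ k) {A : ι → 𝒳 → ℝ} {b : ℝ}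
    (hA : ∀ i, Measurable (A i)) (hAb : ∀ i x, |A i x| ≤ b)
    (hcontr : ∀ s t x, |φ s x - φ t x| ≤ |∑ i, v s i * A i x - ∑ i, v t i * A i x|)
    (hdom : ∀ t x, |φ t x| ≤ |∑ i, v t i * A i x|) (N : ℕ) (z : ι → ℝ) :
    ∫⁻ x, ENNReal.ofReal (T.sup' hT fun t =>
        Real.exp (∑ i, v t i * z i + ∑ n, (φ t (x n) - ∫ y, φ t y ∂μ)))
        ∂(Measure.pi fun _ : Fin N => μ) ≤
      ENNReal.ofReal (Real.exp (N * ((2 * (Fintype.card ι * k) * b) ^ 2 / 2)) *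
        ∑ i, 2 * Real.cosh (Fintype.card ι * k * z i)) := by
  set s : ℝ := Fintype.card ι * k
  -- The vector `z` collects the linear terms of the observations already symmetrized, so it must
  -- vary.
  induction N generalizing z with
  | zero =>
    simp only [Finset.univ_eq_empty, Finset.sum_empty, add_zero, lintegral_const, measure_univ,
      mul_one, Nat.cast_zero, zero_mul, Real.exp_zero, one_mul]
    exact ENNReal.ofReal_le_ofReal (Finset.sup'_le _ _ fun t _ => exp_sum_le_sum_cosh _ _ (hv t))
  | succ N ih =>
    set W : (ι → ℝ) → (Fin N → 𝒳) → ℝ := fun w y => T.sup' hT fun t =>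
      Real.exp (∑ i, v t i * w i + ∑ n, (φ t (y n) - ∫ y, φ t y ∂μ)) with hW
    have hWmeas : ∀ r : ℝ, Measurable fun p : 𝒳 × (Fin N → 𝒳) =>
        W (fun i => z i + r * A i p.1) p.2 := fun r =>
      measurable_sup'_exp hT fun t => by fun_prop
    have hW0 : ∀ w y, 0 ≤ W w y := fun w y => sup'_exp_nonneg hT _
    have hsplit := (measurePreserving_piFinSuccAbove (fun _ : Fin (N + 1) => μ) 0).symm.lintegral_comp
      (f := fun x : Fin (N + 1) → 𝒳 => ENNReal.ofReal (T.sup' hT fun t =>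
        Real.exp (∑ i, v t i * z i + ∑ n, (φ t (x n) - ∫ y, φ t y ∂μ))))
      (measurable_sup'_exp hT fun t => by fun_prop).ennreal_ofReal
    rw [← hsplit]
    simp only [MeasurableEquiv.piFinSuccAbove_symm_apply, Fin.insertNthEquiv_apply,
      Fin.insertNth_zero, Fin.sum_univ_succ, Fin.cons_zero, Fin.cons_succ, cast_eq]
    rw [lintegral_prod_symm' _ (by
      refine (measurable_sup'_exp hT fun t => ?_).ennreal_ofReal
      fun_prop)]
    have hstep : ∀ y : Fin N → 𝒳,
        ∫⁻ x, ENNReal.ofReal (T.sup' hT fun t => Real.exp (∑ i, v t i * z i +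
          (φ t x - ∫ y, φ t y ∂μ + ∑ n, (φ t (y n) - ∫ y, φ t y ∂μ)))) ∂μ ≤
        ∫⁻ x, ENNReal.ofReal ((W (fun i => z i + 2 * A i x) y +
          W (fun i => z i + (-2) * A i x) y) / 2) ∂μ := by
      intro y
      refine le_trans (le_of_eq ?_) ((lintegral_sup'_exp_centered_le μ hT
        (fun t => ∑ i, v t i * z i + ∑ n, (φ t (y n) - ∫ y, φ t y ∂μ)) hφ hM).trans
          (lintegral_mono fun x => ENNReal.ofReal_le_ofReal ?_))
      · refine lintegral_congr fun x => ?_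
        refine congrArg ENNReal.ofReal (Finset.sup'_congr hT rfl fun t _ => ?_)
        rw [Real.exp_eq_exp]
        ring
      · refine div_le_div_of_nonneg_right ((sup'_exp_add_sup'_exp_le hT _ (fun t => 2 * φ t x)
          (fun t => 2 * ∑ i, v t i * A i x) (fun s t => ?_) fun t => ?_).trans (le_of_eq ?_))
            two_pos.le
        · rw [← mul_sub, ← mul_sub, abs_mul, abs_mul]
          exact mul_le_mul_of_nonneg_left (hcontr s t x) (abs_nonneg _)
        · rw [abs_mul, abs_mul]
          exact mul_le_mul_of_nonneg_left (hdom t x) (abs_nonneg _)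
        · have hlin : ∀ (t : τ) (r : ℝ), ∑ i, v t i * (z i + r * A i x) =
              ∑ i, v t i * z i + r * ∑ i, v t i * A i x := fun t r => by
            rw [Finset.mul_sum, ← Finset.sum_add_distrib]
            exact Finset.sum_congr rfl fun i _ => by ring
          simp only [hW, hlin]
          refine congrArg₂ (· + ·) (Finset.sup'_congr hT rfl fun t _ => ?_)
            (Finset.sup'_congr hT rfl fun t _ => ?_) <;>
          · rw [Real.exp_eq_exp]
            ring
    refine (lintegral_mono hstep).trans ?_
    have hjoint : AEMeasurable (Function.uncurry fun (y : Fin N → 𝒳) x =>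
        ENNReal.ofReal ((W (fun i => z i + 2 * A i x) y + W (fun i => z i + (-2) * A i x) y) / 2))
        ((Measure.pi fun _ : Fin N => μ).prod μ) :=
      ((((hWmeas 2).add (hWmeas (-2))).div_const 2).ennreal_ofReal.comp
        measurable_swap).aemeasurable
    -- With the new observation `x` frozen, the induction hypothesis applies at the two shifted
    -- vectors `z ± 2 A x`.
    rw [lintegral_lintegral_swap hjoint]
    -- `cosh (u + w) + cosh (u - w) = 2 cosh u cosh w` and `cosh w ≤ exp (w ^ 2 / 2)`.
    have hcosh : ∀ x i, Real.cosh (s * (z i + 2 * A i x)) + Real.cosh (s * (z i + (-2) * A i x)) ≤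
        2 * (Real.exp ((2 * s * b) ^ 2 / 2) * Real.cosh (s * z i)) := by
      intro x i
      rw [show s * (z i + 2 * A i x) = s * z i + 2 * s * A i x by ring,
        show s * (z i + (-2) * A i x) = s * z i - 2 * s * A i x by ring, Real.cosh_add,
        Real.cosh_sub]
      have h1 : Real.cosh (2 * s * A i x) ≤ Real.exp ((2 * s * b) ^ 2 / 2) := by
        refine (Real.cosh_le_exp_half_sq _).trans (Real.exp_le_exp.2 ?_)
        rw [mul_pow, mul_pow _ b]
        have := sq_le_sq.2 ((hAb i x).trans (le_abs_self b))
        gcongr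
      nlinarith [mul_le_mul_of_nonneg_left h1 (Real.cosh_pos (s * z i)).le]
    have hbound : ∀ x, ∫⁻ y, ENNReal.ofReal ((W (fun i => z i + 2 * A i x) y +
          W (fun i => z i + (-2) * A i x) y) / 2) ∂(Measure.pi fun _ : Fin N => μ) ≤
        ENNReal.ofReal (Real.exp ((N + 1 : ℕ) * ((2 * s * b) ^ 2 / 2)) *
          ∑ i, 2 * Real.cosh (s * z i)) := by
      intro x
      have hWm : ∀ w, Measurable (W w) := fun w => measurable_sup'_exp hT fun t => by fun_prop
      have hhalf : ∀ u : ℝ, 0 ≤ u → ENNReal.ofReal (u / 2) = ENNReal.ofReal 2⁻¹ * ENNReal.ofReal u :=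
        fun u hu => by rw [← ENNReal.ofReal_mul (by positivity), div_eq_inv_mul]
      simp_rw [hhalf _ (add_nonneg (hW0 _ _) (hW0 _ _)), ENNReal.ofReal_add (hW0 _ _) (hW0 _ _)]
      rw [lintegral_const_mul _ (by exact (hWm _).ennreal_ofReal.add (hWm _).ennreal_ofReal),
        lintegral_add_left (hWm _).ennreal_ofReal]
      have hnn : ∀ w : ι → ℝ, 0 ≤ Real.exp (N * ((2 * s * b) ^ 2 / 2)) *
          ∑ i, 2 * Real.cosh (s * w i) := fun w => mul_nonneg (Real.exp_pos _).le
        (Finset.sum_nonneg fun i _ => mul_nonneg two_pos.le (Real.cosh_pos _).le)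
      refine (mul_le_mul_right (add_le_add (ih _) (ih _)) _).trans ?_
      rw [← ENNReal.ofReal_add (hnn _) (hnn _), ← ENNReal.ofReal_mul (by positivity)]
      refine ENNReal.ofReal_le_ofReal ?_
      rw [Nat.cast_succ, add_mul, one_mul, Real.exp_add, ← mul_add, mul_left_comm,
        mul_assoc (Real.exp (N * ((2 * s * b) ^ 2 / 2)))]
      refine mul_le_mul_of_nonneg_left ?_ (Real.exp_pos _).le
      rw [← Finset.sum_add_distrib, Finset.mul_sum, Finset.mul_sum]
      exact Finset.sum_le_sum fun i _ => by linarith [hcosh x i]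
    refine (lintegral_mono hbound).trans (le_of_eq ?_)
    rw [lintegral_const, measure_univ, mul_one]

/-- A sub-Gaussian bound for the moment generating function of the largest deviation of empirical
means over a finite family that is dominated, in the sense of contractions, by a linear family. -/
theorem lintegral_exp_mul_sup'_abs_integral_sub_mean_le {𝒳 τ ι : Type*} [MeasurableSpace 𝒳]
    (μ : Measure 𝒳) [IsProbabilityMeasure μ] [Fintype ι] [Nonempty ι] {T : Finset τ}
    (hT : T.Nonempty) {f : τ → 𝒳 → ℝ} (hf : ∀ t, Measurable (f t)) {M : ℝ}
    (hM : ∀ t x, |f t x| ≤ M) {v : τ → ι → ℝ} {k : ℝ} (hv : ∀ t i, |v t i| ≤ k) {A : ι → 𝒳 → ℝ}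
    {b : ℝ} (hA : ∀ i, Measurable (A i)) (hAb : ∀ i x, |A i x| ≤ b) {L : ℝ} (hL : 0 ≤ L)
    (hcontr : ∀ s t x, |f s x - f t x| ≤ L * |∑ i, v s i * A i x - ∑ i, v t i * A i x|)
    (hdom : ∀ t x, |f t x| ≤ L * |∑ i, v t i * A i x|) {N : ℕ} (hN : 1 ≤ N) {r : ℝ}
    (hr : 0 ≤ r) :
    ∫⁻ x, ENNReal.ofReal (Real.exp (r * T.sup' hT fun t =>
        |∫ y, f t y ∂μ - (N : ℝ)⁻¹ * ∑ n, f t (x n)|)) ∂(Measure.pi fun _ : Fin N => μ) ≤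
      ENNReal.ofReal (4 * Fintype.card ι *
        Real.exp (2 * (Fintype.card ι * k * L * b) ^ 2 * r ^ 2 / N)) := by
  have hN0 : (N : ℝ) ≠ 0 := by positivity
  have hq : 0 ≤ r / N := by positivity
  -- The two signs `σ` resolve the absolute value. The scale `r / N * L` is absorbed into `A`, and
  -- `z = 0` turns each cosine into 1.
  have key : ∀ σ : ℝ, |σ| = 1 → ∫⁻ x, ENNReal.ofReal (T.sup' hT fun t =>
        Real.exp (∑ n, (σ * (r / N * f t (x n)) - ∫ y, σ * (r / N * f t y) ∂μ)))
        ∂(Measure.pi fun _ : Fin N => μ) ≤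
      ENNReal.ofReal (2 * Fintype.card ι *
        Real.exp (2 * (Fintype.card ι * k * L * b) ^ 2 * r ^ 2 / N)) := by
    intro σ hσ
    have hlin : ∀ t x, ∑ i, v t i * (r / N * L * A i x) = r / N * (L * ∑ i, v t i * A i x) := by
      intro t x
      rw [Finset.mul_sum, Finset.mul_sum]
      exact Finset.sum_congr rfl fun i _ => by ring
    have := lintegral_sup'_exp_sum_centered_le μ hT (φ := fun t x => σ * (r / N * f t x))
      (fun t => by fun_prop) (M := r / N * M) (fun t x => ?_) hv
      (A := fun i x => r / N * L * A i x) (b := r / N * L * b)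
      (fun i => by fun_prop) (fun i x => ?_) (fun s t x => ?_) (fun t x => ?_) N 0
    · simp only [Pi.zero_apply, mul_zero, Finset.sum_const_zero, zero_add, Real.cosh_zero, mul_one,
        Finset.sum_const, Finset.card_univ, nsmul_eq_mul] at this
      refine this.trans (le_of_eq ?_)
      rw [mul_comm, mul_comm _ (2 : ℝ)]
      congr 3
      field_simp
    · rw [abs_mul, hσ, one_mul, abs_mul, abs_of_nonneg hq]
      exact mul_le_mul_of_nonneg_left (hM t x) hq
    · rw [abs_mul, abs_of_nonneg (mul_nonneg hq hL)]
      exact mul_le_mul_of_nonneg_left (hAb i x) (mul_nonneg hq hL)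
    · rw [← mul_sub, ← mul_sub, abs_mul, hσ, one_mul, abs_mul, hlin, hlin, ← mul_sub, ← mul_sub,
        abs_mul (r / N : ℝ), abs_mul L, abs_of_nonneg hL]
      exact mul_le_mul_of_nonneg_left (hcontr s t x) (abs_nonneg _)
    · rw [abs_mul, hσ, one_mul, abs_mul, hlin, abs_mul (r / N : ℝ), abs_mul L, abs_of_nonneg hL]
      exact mul_le_mul_of_nonneg_left (hdom t x) (abs_nonneg _)
  have hsum : ∀ (σ : ℝ) t (x : Fin N → 𝒳),
      ∑ n, (σ * (r / N * f t (x n)) - ∫ y, σ * (r / N * f t y) ∂μ) =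
        -σ * (r * (∫ y, f t y ∂μ - (N : ℝ)⁻¹ * ∑ n, f t (x n))) := by
    intro σ t x
    rw [Finset.sum_sub_distrib, integral_const_mul, integral_const_mul, ← Finset.mul_sum,
      ← Finset.mul_sum]
    simp only [Finset.sum_const, Finset.card_univ, Fintype.card_fin, nsmul_eq_mul]
    field_simp
    ring
  have hmeas : ∀ σ : ℝ, Measurable fun x : Fin N → 𝒳 => ENNReal.ofReal (T.sup' hT fun t =>
      Real.exp (∑ n, (σ * (r / N * f t (x n)) - ∫ y, σ * (r / N * f t y) ∂μ))) := fun σ =>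
    (measurable_sup'_exp hT fun t => by fun_prop).ennreal_ofReal
  have hpt : ∀ x : Fin N → 𝒳, ENNReal.ofReal (Real.exp (r * T.sup' hT fun t =>
      |∫ y, f t y ∂μ - (N : ℝ)⁻¹ * ∑ n, f t (x n)|)) ≤
      ENNReal.ofReal (T.sup' hT fun t =>
        Real.exp (∑ n, ((-1) * (r / N * f t (x n)) - ∫ y, (-1) * (r / N * f t y) ∂μ))) +
      ENNReal.ofReal (T.sup' hT fun t =>
        Real.exp (∑ n, (1 * (r / N * f t (x n)) - ∫ y, 1 * (r / N * f t y) ∂μ))) := by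
    intro x
    obtain ⟨t, ht, ht'⟩ := T.exists_mem_eq_sup' hT fun t =>
      |∫ y, f t y ∂μ - (N : ℝ)⁻¹ * ∑ n, f t (x n)|
    rw [ht']
    have hle := fun σ : ℝ => T.le_sup' (fun t => Real.exp
      (∑ n, (σ * (r / N * f t (x n)) - ∫ y, σ * (r / N * f t y) ∂μ))) ht
    rcases abs_choice (∫ y, f t y ∂μ - (N : ℝ)⁻¹ * ∑ n, f t (x n)) with h | h
    · refine le_add_right (ENNReal.ofReal_le_ofReal ((hle (-1)).trans' (le_of_eq ?_)))
      rw [hsum, h, neg_neg, one_mul]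
    · refine le_add_left (ENNReal.ofReal_le_ofReal ((hle 1).trans' (le_of_eq ?_)))
      rw [hsum, h, mul_neg, neg_one_mul]
  refine (lintegral_mono hpt).trans ?_
  rw [lintegral_add_left (hmeas (-1))]
  refine (add_le_add (key (-1) (by simp)) (key 1 (by simp))).trans (le_of_eq ?_)
  rw [← ENNReal.ofReal_add (by positivity) (by positivity)]
  congr 1
  ring

/-! ### From exponential moments to mean and tail -/

/-- Moment and tail bounds for a nonnegative random variable with a sub-Gaussian moment generating
function. -/
theorem moment_and_tail_of_lintegral_exp_le {Ω : Type*} [MeasurableSpace Ω] {P : Measure Ω}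
    {X : Ω → ℝ} (hX : Measurable X) (hX0 : ∀ ω, 0 ≤ X ω)
    {C D n : ℝ} (hC : 0 ≤ C) (hD : 0 < D) (hn : 0 < n)
    (h : ∀ r : ℝ, 0 ≤ r →
      ∫⁻ ω, ENNReal.ofReal (Real.exp (r * X ω)) ∂P ≤ ENNReal.ofReal (C * Real.exp (D * r ^ 2 / n))) :
    Integrable X P ∧ ∫ ω, X ω ∂P ≤ C * Real.exp D / √n ∧
      ∀ ε : ℝ, 0 < ε → P.real {ω | ε ≤ X ω} ≤ C * Real.exp (-(1 / (4 * D)) * n * ε ^ 2) := by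
  have hexp : ∀ r : ℝ, 0 ≤ r → Integrable (fun ω => Real.exp (r * X ω)) P ∧
      ∫ ω, Real.exp (r * X ω) ∂P ≤ C * Real.exp (D * r ^ 2 / n) := by
    intro r hr
    have hm : AEStronglyMeasurable (fun ω => Real.exp (r * X ω)) P := by fun_prop
    refine ⟨⟨hm, ?_⟩, ?_⟩
    · rw [hasFiniteIntegral_iff_ofReal (.of_forall fun ω => (Real.exp_pos _).le)]
      exact (h r hr).trans_lt ENNReal.ofReal_lt_top
    · rw [integral_eq_lintegral_of_nonneg_ae (.of_forall fun ω => (Real.exp_pos _).le) hm]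
      exact ENNReal.toReal_le_of_le_ofReal (by positivity) (h r hr)
  have hsq : 0 < √n := Real.sqrt_pos.2 hn
  obtain ⟨hi, hb⟩ := hexp √n hsq.le
  -- At `r = √n` the exponent `D * r ^ 2 / n` is just `D`, and the division by `√n` gives the rate.
  have hle : ∀ ω, X ω ≤ Real.exp (√n * X ω) / √n := fun ω => by
    rw [le_div_iff₀ hsq, mul_comm]
    linarith [Real.add_one_le_exp (√n * X ω)]
  have hXi : Integrable X P := (hi.div_const √n).mono' hX.aestronglyMeasurable
    (.of_forall fun ω => by rw [Real.norm_eq_abs, abs_of_nonneg (hX0 ω)]; exact hle ω)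
  refine ⟨hXi, ?_, fun ε hε => ?_⟩
  · refine (integral_mono hXi (hi.div_const √n) hle).trans ?_
    rw [integral_div]
    rw [Real.sq_sqrt hn.le, mul_div_cancel_right₀ _ hn.ne'] at hb
    exact div_le_div_of_nonneg_right hb hsq.le
  -- This `r` minimizes the Chernoff exponent `D * r ^ 2 / n - r * ε`.
  · set r := n * ε / (2 * D) with hr
    have hr0 : 0 < r := by positivity
    obtain ⟨hi, hb⟩ := hexp r hr0.le
    have hmarkov := mul_meas_ge_le_integral_of_nonneg
      (.of_forall fun ω => (Real.exp_pos _).le) hi (Real.exp (r * ε))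
    have hset : {ω | Real.exp (r * ε) ≤ Real.exp (r * X ω)} = {ω | ε ≤ X ω} := by
      ext ω
      simp [hr0]
    rw [hset] at hmarkov
    have hfin := hmarkov.trans hb
    rw [← le_div_iff₀' (Real.exp_pos _), mul_div_assoc, ← Real.exp_sub] at hfin
    refine hfin.trans (le_of_eq ?_)
    congr 2
    rw [hr]
    field_simp
    ring

/-! ### Finite nets of strategies and measurability -/

theorem integral_empiricalMeasure {𝒳 : Type*} [MeasurableSpace 𝒳] {N : ℕ} (x : Fin N → 𝒳)
    {f : 𝒳 → ℝ} (hf : Measurable f) :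
    ∫ y, f y ∂(empiricalMeasure x) = (N : ℝ)⁻¹ * ∑ n, f (x n) := by
  rw [empiricalMeasure, integral_smul_measure, integral_finsetSum_measure]
  · simp [integral_dirac' _ _ hf.stronglyMeasurable]
  · exact fun n _ => (integrable_dirac' hf.stronglyMeasurable) (by simp)

/-- A nonempty bounded set in a Euclidean space has finite nets. -/
theorem exists_finset_forall_exists_norm_sub_le {e : ℕ} {𝒢 : Set (EuclideanSpace ℝ (Fin e))}
    (h𝒢 : 𝒢.Nonempty) {K : ℝ} (hK : ∀ g ∈ 𝒢, ‖g‖ ≤ K) {η : ℝ} (hη : 0 < η) :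
    ∃ T : Finset 𝒢, T.Nonempty ∧ ∀ g : 𝒢, ∃ t ∈ T, ‖(g : EuclideanSpace ℝ (Fin e)) - t‖ ≤ η := by
  classical
  have htb : TotallyBounded 𝒢 := 
    (Bornology.IsBounded.isCompact_closure (isBounded_iff_forall_norm_le.2
      ⟨K, hK⟩)).totallyBounded.subset subset_closure
  obtain ⟨t, hts, htf, hcov⟩ := Metric.finite_approx_of_totallyBounded htb η hη
  have hnet : ∀ g : 𝒢, ∃ t ∈ htf.toFinset.subtype (· ∈ 𝒢),
      ‖(g : EuclideanSpace ℝ (Fin e)) - t‖ ≤ η := by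
    intro g
    obtain ⟨y, hy, hgy⟩ := Set.mem_iUnion₂.1 (hcov g.2)
    exact ⟨⟨y, hts hy⟩, by simpa using hy, by rw [← dist_eq_norm]; exact (Metric.mem_ball.1 hgy).le⟩
  refine ⟨_, ?_, hnet⟩
  obtain ⟨g, hg⟩ := h𝒢
  obtain ⟨t, ht, -⟩ := hnet ⟨g, hg⟩
  exact ⟨t, ht⟩

section Position

variable {𝒳 : Type*} {e : ℕ} {B K : ℝ} {F : 𝒳 → ℝ} {G : Fin e → 𝒳 → ℝ}

theorem abs_coord_le_of_norm_le {g : EuclideanSpace ℝ (Fin e)} (hg : ‖g‖ ≤ K) (i : Fin e) :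
    |g i| ≤ K :=
  (PiLp.norm_apply_le g i).trans hg

theorem abs_tradedPosition_le (hF : ∀ x, |F x| ≤ B) (hG : ∀ i x, |G i x| ≤ B)
    {g : EuclideanSpace ℝ (Fin e)} (hg : ‖g‖ ≤ K) (x : 𝒳) :
    |tradedPosition F G g x| ≤ |B| + e * (|K| * |B|) := by
  refine (abs_add_le _ _).trans (add_le_add ((hF x).trans (le_abs_self B)) ?_)
  refine (Finset.abs_sum_le_sum_abs _ _).trans ((Finset.sum_le_sum fun i _ => ?_).trans_eq
    (by simp : ∑ _i : Fin e, |K| * |B| = e * (|K| * |B|)))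
  rw [abs_mul]
  exact mul_le_mul ((abs_coord_le_of_norm_le hg i).trans (le_abs_self K))
    ((hG i x).trans (le_abs_self B)) (abs_nonneg _) (abs_nonneg _)

theorem abs_tradedPosition_sub_le (hG : ∀ i x, |G i x| ≤ B)
    (g h : EuclideanSpace ℝ (Fin e)) (x : 𝒳) :
    |tradedPosition F G g x - tradedPosition F G h x| ≤ e * |B| * ‖g - h‖ := by
  rw [tradedPosition, tradedPosition, add_sub_add_left_eq_sub, ← Finset.sum_sub_distrib]
  refine (Finset.abs_sum_le_sum_abs _ _).trans ((Finset.sum_le_sum fun i _ => ?_).trans_eq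
    (by simp; ring : ∑ _i : Fin e, ‖g - h‖ * |B| = e * |B| * ‖g - h‖))
  rw [← sub_mul, abs_mul]
  exact mul_le_mul (abs_coord_le_of_norm_le (g := g - h) le_rfl i)
    ((hG i x).trans (le_abs_self B)) (abs_nonneg _) (norm_nonneg _)

theorem measurable_tradedPosition [MeasurableSpace 𝒳] (hF : Measurable F)
    (hG : ∀ i, Measurable (G i)) (g : EuclideanSpace ℝ (Fin e)) :
    Measurable (tradedPosition F G g) := by
  unfold tradedPosition
  fun_prop

end Position

/-- The maximal utility is approximated, uniformly over all probability measures, by maxima over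
finitely many strategies. -/
theorem exists_finset_forall_abs_sub_sup'_le {𝒳 : Type*} [MeasurableSpace 𝒳] {e : ℕ}
    {U : ℝ → ℝ} {F : 𝒳 → ℝ} {G : Fin e → 𝒳 → ℝ} {𝒢 : Set (EuclideanSpace ℝ (Fin e))}
    (h𝒢 : 𝒢.Nonempty) {K : ℝ} (hK : ∀ g ∈ 𝒢, ‖g‖ ≤ K)
    (hmeas : ∀ g, Measurable fun x => U (tradedPosition F G g x)) {M : ℝ}
    (hM : ∀ g ∈ 𝒢, ∀ x, |U (tradedPosition F G g x)| ≤ M) {Λ : ℝ} (hΛ : 0 ≤ Λ)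
    (hlip : ∀ g ∈ 𝒢, ∀ h ∈ 𝒢, ∀ x,
      |U (tradedPosition F G g x) - U (tradedPosition F G h x)| ≤ Λ * ‖g - h‖)
    {δ : ℝ} (hδ : 0 < δ) :
    ∃ (T : Finset 𝒢) (hT : T.Nonempty), ∀ (ν : Measure 𝒳) [IsProbabilityMeasure ν],
      |maxUtility U G 𝒢 ν F -
        T.sup' hT fun t => expectedUtility U ν (tradedPosition F G t)| ≤ δ := by
  -- The `+ 1` keeps the mesh defined when `Λ = 0`.
  obtain ⟨T, hT, hnet⟩ := exists_finset_forall_exists_norm_sub_le h𝒢 hK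
    (η := δ / (Λ + 1)) (by positivity)
  refine ⟨T, hT, fun ν _ => ?_⟩
  have hint : ∀ g ∈ 𝒢, Integrable (fun x => U (tradedPosition F G g x)) ν := fun g hg =>
    .of_bound (hmeas g).aestronglyMeasurable M (.of_forall fun x => hM g hg x)
  have hle : ∀ y ∈ (fun g => expectedUtility U ν (tradedPosition F G g)) '' 𝒢,
      y ≤ (T.sup' hT fun t => expectedUtility U ν (tradedPosition F G t)) + δ := by
    rintro _ ⟨g, hg, rfl⟩
    obtain ⟨t, ht, hgt⟩ := hnet ⟨g, hg⟩
    refine le_trans ?_ (add_le_add_left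
      (T.le_sup' (fun t : 𝒢 => expectedUtility U ν (tradedPosition F G t)) ht) δ)
    have : ∫ x, U (tradedPosition F G g x) ∂ν ≤ ∫ x, (U (tradedPosition F G t x) + δ) ∂ν := by
      refine integral_mono (hint g hg) ((hint t t.2).add (integrable_const δ)) fun x => ?_
      have h1 := (le_abs_self _).trans (hlip g hg t t.2 x)
      have h2 : Λ * ‖g - t‖ ≤ δ := by
        refine (mul_le_mul_of_nonneg_left hgt hΛ).trans ?_
        rw [mul_div_assoc', div_le_iff₀ (by positivity)]
        nlinarith
      simp only
      linarith
    rw [integral_add (hint t t.2) (integrable_const δ)] at this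
    simpa [expectedUtility] using this
  have h1 := csSup_le (h𝒢.image _) hle
  have h2 : (T.sup' hT fun t => expectedUtility U ν (tradedPosition F G t)) ≤
      maxUtility U G 𝒢 ν F :=
    Finset.sup'_le _ _ fun t _ => le_csSup ⟨_, hle⟩ ⟨t, t.2, rfl⟩
  rw [abs_of_nonneg (sub_nonneg.2 h2)]
  exact sub_le_iff_le_add'.2 h1

theorem abs_sup'_sub_sup'_le {τ : Type*} {T : Finset τ} (hT : T.Nonempty) (f g : τ → ℝ) :
    |T.sup' hT f - T.sup' hT g| ≤ T.sup' hT fun t => |f t - g t| := by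
  have h : ∀ t ∈ T, |f t - g t| ≤ T.sup' hT fun t => |f t - g t| :=
    fun t ht => T.le_sup' (fun t => |f t - g t|) ht
  refine abs_sub_le_iff.2 ⟨sub_le_iff_le_add'.2 (Finset.sup'_le _ _ fun t ht => ?_),
    sub_le_iff_le_add'.2 (Finset.sup'_le _ _ fun t ht => ?_)⟩
  · linarith [le_abs_self (f t - g t), h t ht, T.le_sup' g ht]
  · linarith [neg_abs_le (f t - g t), h t ht, T.le_sup' f ht]

/-- The supremum may run over uncountably many strategies, but it is a pointwise limit of finite
maxima, whose nets do not depend on the sample. -/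
theorem measurable_maxUtility_empiricalMeasure {𝒳 : Type*} [MeasurableSpace 𝒳] {e : ℕ}
    {U : ℝ → ℝ} {F : 𝒳 → ℝ} {G : Fin e → 𝒳 → ℝ} {𝒢 : Set (EuclideanSpace ℝ (Fin e))}
    (hmeas : ∀ g, Measurable fun x => U (tradedPosition F G g x))
    (happrox : ∀ δ : ℝ, 0 < δ → ∃ (T : Finset 𝒢) (hT : T.Nonempty),
      ∀ (ν : Measure 𝒳) [IsProbabilityMeasure ν], |maxUtility U G 𝒢 ν F -
        T.sup' hT fun t => expectedUtility U ν (tradedPosition F G t)| ≤ δ)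
    {N : ℕ} (hN : 1 ≤ N) :
    Measurable fun x : Fin N → 𝒳 => maxUtility U G 𝒢 (empiricalMeasure x) F := by
  choose T hT h using fun n : ℕ => happrox (1 / ((n : ℝ) + 1)) (by positivity)
  refine measurable_of_tendsto_metrizable
    (f := fun (n : ℕ) (x : Fin N → 𝒳) => (T n).sup' (hT n) fun t =>
      expectedUtility U (empiricalMeasure x) (tradedPosition F G t)) (fun n => ?_)
    (tendsto_pi_nhds.2 fun x => ?_)
  · have := Finset.measurable_sup' (hT n)
      (f := fun (t : 𝒢) (x : Fin N → 𝒳) =>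
        (N : ℝ)⁻¹ * ∑ n, U (tradedPosition F G t (x n))) fun t _ =>
          (Finset.measurable_fun_sum _ fun n _ =>
            (hmeas t).comp (measurable_pi_apply n)).const_mul _
    convert this using 1
    ext x
    simp [expectedUtility, integral_empiricalMeasure x (hmeas _)]
  · have := isProbabilityMeasure_empiricalMeasure hN x
    rw [tendsto_iff_dist_tendsto_zero]
    refine squeeze_zero (fun _ => dist_nonneg) (fun n => ?_) tendsto_one_div_add_atTop_nhds_zero_nat
    rw [dist_comm]
    exact h n (empiricalMeasure x)

/-! ### Assembly of the constants and the limit of fine nets -/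

theorem mainTheorem5 (U : ℝ → ℝ) (hU : ConcaveOn ℝ Set.univ U) (hUmono : Monotone U)
    (e : ℕ) (B K : ℝ) :
    ∃ c C : ℝ, 0 < c ∧ 0 < C ∧
      ∀ (𝒳 : Type*) [MeasurableSpace 𝒳] (μ : Measure 𝒳) [IsProbabilityMeasure μ]
        (F : 𝒳 → ℝ) (G : Fin e → 𝒳 → ℝ) (𝒢 : Set (EuclideanSpace ℝ (Fin e))),
        Measurable F → (∀ i, Measurable (G i)) →
        (∀ x, |F x| ≤ B) → (∀ i x, |G i x| ≤ B) →
        𝒢.Nonempty → (∀ g ∈ 𝒢, ‖g‖ ≤ K) →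
        -- the expectations and the supremum in the maximal utility are finite
        (∀ (ν : Measure 𝒳) [IsProbabilityMeasure ν],
          (∀ g ∈ 𝒢, Integrable (fun x => U (tradedPosition F G g x)) ν) ∧
          BddAbove ((fun g => expectedUtility U ν (tradedPosition F G g)) '' 𝒢)) ∧
        -- the moment bound and the deviation inequality
        ∀ (Ω : Type*) [MeasurableSpace Ω] (P : Measure Ω) [IsProbabilityMeasure P]
          (N : ℕ), 1 ≤ N →
          ∀ S : Fin N → Ω → 𝒳, (∀ n, Measurable (S n)) → (∀ n, P.map (S n) = μ) →
            iIndepFun S P →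
            Integrable (fun ω => |maxUtility U G 𝒢 μ F -
              maxUtility U G 𝒢 (empiricalMeasure fun n => S n ω) F|) P ∧
            ∫ ω, |maxUtility U G 𝒢 μ F -
              maxUtility U G 𝒢 (empiricalMeasure fun n => S n ω) F| ∂P ≤ C / √(N : ℝ) ∧
            ∀ ε : ℝ, 0 < ε →
              P.real {ω | ε ≤ |maxUtility U G 𝒢 μ F -
                maxUtility U G 𝒢 (empiricalMeasure fun n => S n ω) F|} ≤
                C * Real.exp (-c * N * ε ^ 2) := by
  set R : ℝ := |B| + e * (|K| * |B|)
  obtain ⟨L, hL, hLip⟩ := exists_abs_sub_le_of_concaveOn_of_monotone hU hUmono R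
  -- There are `e + 1` coordinates: `none` carries `F` with weight 1, so the index type is nonempty
  -- even for `e = 0`.
  set m : ℝ := ((Fintype.card (Option (Fin e)) : ℕ) : ℝ)
  have hm0 : 0 < m := Nat.cast_pos.2 Fintype.card_pos
  -- The `+ 1` keeps `D` positive when `L` or `B` vanishes.
  set D : ℝ := 2 * (m * (1 + |K|) * L * |B|) ^ 2 + 1
  have hD0 : 0 < D := by positivity
  refine ⟨1 / (4 * D), 4 * m * Real.exp D, by positivity, by positivity, ?_⟩
  intro 𝒳 _ μ _ F G 𝒢 hF hG hFB hGB h𝒢 hK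
  have hpos : ∀ g ∈ 𝒢, ∀ x, |tradedPosition F G g x| ≤ R := fun g hg x =>
    abs_tradedPosition_le hFB hGB (hK g hg) x
  have hR0 : |(0 : ℝ)| ≤ R := by rw [abs_zero]; positivity
  have hmeas : ∀ g, Measurable fun x => U (tradedPosition F G g x) := fun g =>
    hUmono.measurable.comp (measurable_tradedPosition hF hG g)
  -- Subtracting `U 0` leaves the deviations unchanged and gives the domination required for
  -- contraction.
  have hdom : ∀ g ∈ 𝒢, ∀ x, |U (tradedPosition F G g x) - U 0| ≤ L * |tradedPosition F G g x| :=
    fun g hg x => by simpa using hLip _ 0 (hpos g hg x) hR0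
  have hdomR : ∀ g ∈ 𝒢, ∀ x, |U (tradedPosition F G g x) - U 0| ≤ L * R := fun g hg x =>
    (hdom g hg x).trans (mul_le_mul_of_nonneg_left (hpos g hg x) hL)
  have hM : ∀ g ∈ 𝒢, ∀ x, |U (tradedPosition F G g x)| ≤ L * R + |U 0| := fun g hg x => by
    linarith [hdomR g hg x, abs_sub_abs_le_abs_sub (U (tradedPosition F G g x)) (U 0)]
  have hint : ∀ (ν : Measure 𝒳) [IsProbabilityMeasure ν], ∀ g ∈ 𝒢,
      Integrable (fun x => U (tradedPosition F G g x)) ν := fun ν _ g hg =>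
    .of_bound (hmeas g).aestronglyMeasurable _ (.of_forall fun x => hM g hg x)
  refine ⟨fun ν _ => ⟨hint ν, L * R + |U 0|, ?_⟩, ?_⟩
  · rintro _ ⟨g, hg, rfl⟩
    have := norm_integral_le_of_norm_le_const (μ := ν)
      (f := fun x => U (tradedPosition F G g x)) (C := L * R + |U 0|) (.of_forall fun x => hM g hg x)
    rw [probReal_univ, mul_one] at this
    exact (le_abs_self _).trans this
  intro Ω _ P _ N hN S hS hSμ hind
  have happrox := fun (δ : ℝ) (hδ : 0 < δ) => exists_finset_forall_abs_sub_sup'_le h𝒢 hK hmeas hM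
    (Λ := L * (e * |B|)) (by positivity) (fun g hg h hh x => by
      rw [mul_assoc]
      exact (hLip _ _ (hpos g hg x) (hpos h hh x)).trans
        (mul_le_mul_of_nonneg_left (abs_tradedPosition_sub_le hGB g h x) hL)) hδ
  have hXmeas : Measurable fun x : Fin N → 𝒳 =>
      |maxUtility U G 𝒢 μ F - maxUtility U G 𝒢 (empiricalMeasure x) F| :=
    (measurable_const.sub (measurable_maxUtility_empiricalMeasure hmeas happrox hN)).abs
  have hSmeas : Measurable fun ω n => S n ω := measurable_pi_iff.2 hS
  have hmap : P.map (fun ω n => S n ω) = Measure.pi fun _ => μ := by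
    rw [(iIndepFun_iff_map_fun_eq_pi_map fun n => (hS n).aemeasurable).1 hind]
    simp_rw [hSμ]
  have hN0 : (0 : ℝ) < N := by exact_mod_cast hN
  set v : 𝒢 → Option (Fin e) → ℝ := fun t i => i.elim 1 fun j => (t : EuclideanSpace ℝ (Fin e)) j
  set A : Option (Fin e) → 𝒳 → ℝ := fun i => i.elim F G
  have hvA : ∀ t x, ∑ i, v t i * A i x = tradedPosition F G t x := fun t x => by
    simp [v, A, Fintype.sum_option, tradedPosition]
  have hdiff : ∀ (t : 𝒢) (x : Fin N → 𝒳),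
      ∫ y, (U (tradedPosition F G t y) - U 0) ∂μ -
        (N : ℝ)⁻¹ * ∑ n, (U (tradedPosition F G t (x n)) - U 0) =
      expectedUtility U μ (tradedPosition F G t) -
        expectedUtility U (empiricalMeasure x) (tradedPosition F G t) := fun t x => by
    rw [expectedUtility, expectedUtility, integral_empiricalMeasure x (hmeas t),
      integral_sub (hint μ t t.2) (integrable_const _), Finset.sum_sub_distrib, mul_sub]
    simp [inv_mul_cancel_left₀ hN0.ne']
  have hmgf : ∀ r : ℝ, 0 ≤ r → ∫⁻ x : Fin N → 𝒳, ENNReal.ofReal (Real.exp (r *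
      |maxUtility U G 𝒢 μ F - maxUtility U G 𝒢 (empiricalMeasure x) F|))
        ∂(Measure.pi fun _ => μ) ≤ ENNReal.ofReal (4 * m * Real.exp (D * r ^ 2 / N)) := by
    intro r hr
    -- A net costs `δ` for `μ` and `δ` for the empirical measure; the bound for the net itself is
    -- independent of `δ`.
    have hlim : Filter.Tendsto (fun δ : ℝ =>
        ENNReal.ofReal (Real.exp (r * (δ + δ)) * (4 * m * Real.exp (D * r ^ 2 / N))))
        (nhdsWithin 0 (Set.Ioi 0)) (nhds (ENNReal.ofReal (4 * m * Real.exp (D * r ^ 2 / N)))) := by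
      refine (Continuous.tendsto' ?_ _ _ (by simp)).mono_left nhdsWithin_le_nhds
      exact ENNReal.continuous_ofReal.comp (by fun_prop)
    refine ge_of_tendsto hlim (eventually_nhdsWithin_of_forall fun δ hδ => ?_)
    obtain ⟨T, hT, hTδ⟩ := happrox δ hδ
    have hfin := lintegral_exp_mul_sup'_abs_integral_sub_mean_le μ hT
      (f := fun t x => U (tradedPosition F G t x) - U 0) (fun t => (hmeas t).sub_const _)
      (fun t x => hdomR t t.2 x) (v := v) (k := 1 + |K|) (fun t i => ?_) (A := A) (b := |B|)
      (fun i => ?_) (fun i x => ?_) hL (fun s t x => ?_) (fun t x => ?_) hN hr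
    · simp_rw [hdiff] at hfin
      rw [ENNReal.ofReal_mul (Real.exp_pos _).le]
      calc _ ≤ ∫⁻ x : Fin N → 𝒳, ENNReal.ofReal (Real.exp (r * (δ + δ))) *
            ENNReal.ofReal (Real.exp (r * T.sup' hT fun t =>
              |expectedUtility U μ (tradedPosition F G t) -
                expectedUtility U (empiricalMeasure x) (tradedPosition F G t)|))
              ∂(Measure.pi fun _ => μ) := by
            refine lintegral_mono fun x => ?_
            have := isProbabilityMeasure_empiricalMeasure hN x
            rw [← ENNReal.ofReal_mul (Real.exp_pos _).le, ← Real.exp_add, ← mul_add]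
            refine ENNReal.ofReal_le_ofReal (Real.exp_le_exp.2 (mul_le_mul_of_nonneg_left ?_ hr))
            have h1 := abs_le.1 (hTδ μ)
            have h2 := abs_le.1 (hTδ (empiricalMeasure x))
            have h3 := abs_le.1 (abs_sup'_sub_sup'_le hT
              (fun t : 𝒢 => expectedUtility U μ (tradedPosition F G t))
              fun t => expectedUtility U (empiricalMeasure x) (tradedPosition F G t))
            exact abs_le.2 ⟨by linarith [h1.1, h2.2, h3.1], by linarith [h1.2, h2.1, h3.2]⟩
        _ ≤ _ := by
            rw [lintegral_const_mul' _ _ ENNReal.ofReal_ne_top]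
            refine mul_le_mul_right (hfin.trans (ENNReal.ofReal_le_ofReal ?_)) _
            refine mul_le_mul_of_nonneg_left (Real.exp_le_exp.2 ?_) (by positivity)
            gcongr
            linarith
    · rcases i with _ | j
      · simp [v]
      · have := abs_coord_le_of_norm_le (hK t t.2) j
        simp only [v, Option.elim]
        linarith [le_abs_self K]
    · rcases i with _ | j
      exacts [hF, hG j]
    · rcases i with _ | j
      exacts [(hFB x).trans (le_abs_self B), (hGB j x).trans (le_abs_self B)]
    · simpa [hvA] using hLip _ _ (hpos s s.2 x) (hpos t t.2 x)
    · simpa [hvA] using hdom t t.2 x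
  refine moment_and_tail_of_lintegral_exp_le (hXmeas.comp hSmeas) (fun ω => abs_nonneg _)
    (C := 4 * m) (by positivity) hD0 hN0 (fun r hr => ?_) |>.imp_right (And.imp_right
      fun h ε hε => (h ε hε).trans ?_)
  · have := hmgf r hr
    rw [← hmap, lintegral_map (hXmeas.const_mul r).exp.ennreal_ofReal hSmeas] at this
    exact this
  · refine mul_le_mul_of_nonneg_right ?_ (Real.exp_pos _).le
    exact le_mul_of_one_le_right (by positivity) (Real.one_le_exp hD0.le)
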